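/- There are absolute constants $C_1,C_2>0$ such that the following holds. Let $d\ge 0$ be an integer, let $\Omega\subset\mathbb R^d$ be compact, let $\mathcal C(\Omega)$ be the space of continuous real-valued functions on $\Omega$ with the uniform norm $\|f\|_\infty=\max_{x\in\Omega}|f(x)|$, and let $X_N\subset\mathcal C(\Omega)$ be a real linear subspace of dimension $N\ge 1$. Then there is a nonempty set of $m\le C_1N$ points $\xi^1,\dots,\xi^m\in\Omega$ such that for every $f\in X_N$ $$\|f\|_\infty\le C_2\sqrt N\,\max_{1\le j\le m}|f(\xi^j)|.$$ -/

import Mathlib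

/-! Take an exact D-optimal design: `2N` points `ξ j` maximizing the determinant of the Gram matrix
`G` of a basis `u` of the space. Moving any one point to `x` cannot increase `det G`; averaging
these inequalities over all points gives `(u x)ᵀ G⁻¹ (u x) ≤ N / (N + 1)`
(`variance_le_of_isMax_det`). Since `f x` is the sum of `f (ξ j)` weighted by `(u (ξ j))ᵀ G⁻¹ (u
x)`, Cauchy–Schwarz yields `f x ^ 2 ≤ ∑ j, f (ξ j) ^ 2`, at most `2N` times the squared maximum over
the design. -/

open Matrix in
/-- The Gram (information) matrix `∑ j, u (ξ j) (u (ξ j))ᵀ` of a design `ξ`. -/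
def designGram {T ι κ : Type*} [Fintype κ] (u : T → ι → ℝ) (ξ : κ → T) : Matrix ι ι ℝ :=
  ∑ j, vecMulVec (u (ξ j)) (u (ξ j))

open Matrix in
theorem designGram_mulVec {T ι κ : Type*} [Fintype κ] [Fintype ι] (u : T → ι → ℝ) (ξ : κ → T)
    (c : ι → ℝ) : designGram u ξ *ᵥ c = ∑ j, (u (ξ j) ⬝ᵥ c) • u (ξ j) := by
  simp [designGram, sum_mulVec, vecMulVec_mulVec]

open Matrix in
theorem dotProduct_designGram_mulVec {T ι κ : Type*} [Fintype κ] [Fintype ι] (u : T → ι → ℝ)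
    (ξ : κ → T) (c y : ι → ℝ) :
    c ⬝ᵥ designGram u ξ *ᵥ y = ∑ j, (u (ξ j) ⬝ᵥ c) * (u (ξ j) ⬝ᵥ y) := by
  rw [designGram_mulVec, dotProduct_sum]
  refine Finset.sum_congr rfl fun j _ => ?_
  rw [dotProduct_smul, smul_eq_mul, dotProduct_comm c, mul_comm]

theorem designGram_transpose {T ι κ : Type*} [Fintype κ] (u : T → ι → ℝ) (ξ : κ → T) :
    (designGram u ξ).transpose = designGram u ξ := by
  simp [designGram, Matrix.transpose_sum]

/-- Factoring the rank-two change lets the matrix determinant lemma reduce an exchange to a `2 × 2`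
determinant. -/
theorem designGram_update {T ι κ : Type*} [Fintype κ] [DecidableEq κ] (u : T → ι → ℝ)
    (ξ : κ → T) (j : κ) (x : T) :
    designGram u (Function.update ξ j x) =
      designGram u ξ + (Matrix.of ![u x, -u (ξ j)]).transpose * Matrix.of ![u x, u (ξ j)] := by
  have h : ∑ k ∈ Finset.univ.erase j, Matrix.vecMulVec (u (Function.update ξ j x k))
      (u (Function.update ξ j x k)) =
      ∑ k ∈ Finset.univ.erase j, Matrix.vecMulVec (u (ξ k)) (u (ξ k)) :=
    Finset.sum_congr rfl fun k hk => by
      rw [Function.update_of_ne (Finset.ne_of_mem_erase hk)]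
  rw [designGram, designGram, ← Finset.add_sum_erase _ _ (Finset.mem_univ j), h,
    ← Finset.add_sum_erase _ (fun k => Matrix.vecMulVec (u (ξ k)) (u (ξ k))) (Finset.mem_univ j)]
  ext a b
  simp [Matrix.vecMulVec_apply, Matrix.mul_apply, Fin.sum_univ_two]
  ring

theorem continuous_det_designGram {T ι κ : Type*} [TopologicalSpace T] [Fintype κ] [Fintype ι]
    [DecidableEq ι] {u : T → ι → ℝ} (hu : Continuous u) :
    Continuous fun ξ : κ → T => (designGram u ξ).det := by
  unfold designGram
  refine Continuous.matrix_det (continuous_finsetSum _ fun j _ => ?_)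
  exact (hu.comp (continuous_apply j)).matrix_vecMulVec (hu.comp (continuous_apply j))

open Matrix in
/-- If the values of `u` separate the coordinate vectors, some design has positive determinant. -/
theorem exists_det_designGram_pos {T ι κ : Type*} [Fintype κ] [Fintype ι] [DecidableEq ι]
    [Nonempty ι] (hcard : Fintype.card ι ≤ Fintype.card κ) {u : T → ι → ℝ}
    (hsep : ∀ c : ι → ℝ, (∀ x, u x ⬝ᵥ c = 0) → c = 0) :
    ∃ ξ : κ → T, 0 < (designGram u ξ).det := by
  classical
  have hspan : Submodule.span ℝ (Set.range u) = ⊤ := by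
    by_contra hne
    obtain ⟨f, hf, hle⟩ := Submodule.exists_le_ker_of_lt_top _ (lt_top_iff_ne_top.2 hne)
    have hfe : ∀ v, f v = v ⬝ᵥ fun i => f (Pi.single i 1) := fun v => by
      conv_lhs => rw [← Finset.univ_sum_single v, map_sum]
      refine Finset.sum_congr rfl fun i _ => ?_
      rw [← smul_eq_mul (v i), ← map_smul, ← Pi.single_smul, smul_eq_mul, mul_one]
    have h0 := hsep (fun i => f (Pi.single i 1)) fun x => by
      rw [← hfe]; exact hle (Submodule.subset_span ⟨x, rfl⟩)
    exact hf (LinearMap.ext fun v => by rw [hfe, h0]; simp)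
  obtain ⟨s, hs, hsspan, hli⟩ := exists_linearIndependent ℝ (Set.range u)
  have : Fintype s := hli.setFinite.fintype
  have hscard : Fintype.card s ≤ Fintype.card κ := by
    refine le_trans ?_ hcard
    simpa using hli.fintype_card_le_finrank
  have hsne : Nonempty s := by
    rw [Set.nonempty_coe_sort, Set.nonempty_iff_ne_empty]
    rintro rfl
    rw [hspan, Submodule.span_empty] at hsspan
    exact bot_ne_top hsspan
  obtain ⟨e⟩ := Function.Embedding.nonempty_of_card_le hscard
  choose p hp using fun y : s => hs y.2
  -- Indices outside the range of `e` receive an arbitrary point; they only add positive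
  -- semidefinite terms.
  refine ⟨fun k => p (Function.invFun e k), ?_⟩
  refine Matrix.PosDef.det_pos (Matrix.PosDef.of_dotProduct_mulVec_pos ?_ fun c hc => ?_)
  · rw [Matrix.IsHermitian, conjTranspose_eq_transpose_of_trivial, designGram_transpose]
  · rw [star_trivial, dotProduct_designGram_mulVec]
    refine lt_of_le_of_ne (Finset.sum_nonneg fun j _ => mul_self_nonneg _) fun h0 => hc ?_
    rw [eq_comm, Finset.sum_eq_zero_iff_of_nonneg fun j _ => mul_self_nonneg _] at h0
    have hz : ∀ v ∈ Submodule.span ℝ s, v ⬝ᵥ c = 0 := fun v hv => by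
      induction hv using Submodule.span_induction with
      | mem y hy =>
        have := h0 (e ⟨y, hy⟩) (Finset.mem_univ _)
        rw [Function.leftInverse_invFun e.injective, hp] at this
        exact mul_self_eq_zero.1 this
      | zero => simp
      | add v w _ _ hv hw => rw [add_dotProduct, hv, hw, add_zero]
      | smul a v _ hv => rw [smul_dotProduct, hv, smul_zero]
    rw [hsspan, hspan] at hz
    exact dotProduct_self_eq_zero.1 (hz c trivial)

open Matrix in
/-- The variance function `(u x)ᵀ G⁻¹ (u x)` of a design `ξ` of maximal determinant, expressed by
the exchange inequality summed over all points of the design. -/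
theorem variance_le_of_isMax_det {T ι κ : Type*} [Fintype κ] [Fintype ι] [DecidableEq ι]
    {u : T → ι → ℝ} {ξ : κ → T} (hpos : 0 < (designGram u ξ).det)
    (hmax : ∀ η : κ → T, (designGram u η).det ≤ (designGram u ξ).det) (x : T) :
    (u x ⬝ᵥ (designGram u ξ)⁻¹ *ᵥ u x) * (Fintype.card κ - Fintype.card ι + 1) ≤
      Fintype.card ι := by
  classical
  set G := designGram u ξ with hG
  have hunit : IsUnit G.det := hpos.ne'.isUnit
  have hsymm : G⁻¹ᵀ = G⁻¹ := by
    rw [transpose_nonsing_inv, hG, designGram_transpose]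
  have hcomm : ∀ v w : ι → ℝ, v ⬝ᵥ G⁻¹ *ᵥ w = w ⬝ᵥ G⁻¹ *ᵥ v := fun v w => by
    rw [dotProduct_mulVec, ← mulVec_transpose, hsymm, dotProduct_comm]
  have hcancel : G *ᵥ (G⁻¹ *ᵥ u x) = u x := by
    rw [mulVec_mulVec, mul_nonsing_inv _ hunit, one_mulVec]
  set d := u x ⬝ᵥ G⁻¹ *ᵥ u x with hd
  have hsq : ∑ j, (u (ξ j) ⬝ᵥ G⁻¹ *ᵥ u x) ^ 2 = d := by
    simp_rw [sq]
    rw [← dotProduct_designGram_mulVec, ← hG, hcancel, dotProduct_comm]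
  -- The variances at the design points sum to `trace (G⁻¹ * G)`.
  have htr : ∑ j, u (ξ j) ⬝ᵥ G⁻¹ *ᵥ u (ξ j) = Fintype.card ι := by
    have hmul : G⁻¹ * G = ∑ j, G⁻¹ * vecMulVec (u (ξ j)) (u (ξ j)) := by
      rw [← Finset.mul_sum]; rfl
    rw [← trace_one (R := ℝ), ← nonsing_inv_mul _ hunit, hmul, trace_sum]
    refine Finset.sum_congr rfl fun j _ => ?_
    rw [mul_vecMulVec, trace_vecMulVec, dotProduct_comm]
  -- The left side is the factor by which the determinant changes when `ξ j` is replaced by `x`.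
  have hex : ∀ j, (1 + d) * (1 - u (ξ j) ⬝ᵥ G⁻¹ *ᵥ u (ξ j)) + (u (ξ j) ⬝ᵥ G⁻¹ *ᵥ u x) ^ 2 ≤ 1 := by
    intro j
    have h := hmax (Function.update ξ j x)
    rw [designGram_update, ← hG, det_add_mul _ _ hunit] at h
    have h2 := le_of_mul_le_mul_left (h.trans_eq (mul_one _).symm) hpos
    have hent : ∀ a b : Fin 2, (of ![u x, u (ξ j)] * G⁻¹ * (of ![u x, -u (ξ j)])ᵀ) a b =
        (![u x, u (ξ j)] a) ⬝ᵥ G⁻¹ *ᵥ (![u x, -u (ξ j)] b) := fun a b => by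
      rw [Matrix.mul_assoc]; rfl
    rw [det_fin_two] at h2
    simp only [Matrix.add_apply, hent] at h2
    simp [mulVec_neg, hcomm (u x) (u (ξ j))] at h2
    nlinarith [h2]
  -- With `n` points and `N` parameters the sum reads `(1 + d) * (n - N) + d ≤ n`.
  have hsum := Finset.sum_le_sum fun j (_ : j ∈ Finset.univ) => hex j
  rw [Finset.sum_add_distrib, ← Finset.mul_sum, Finset.sum_sub_distrib, htr, hsq] at hsum
  simp at hsum
  linarith

open Matrix in
/-- An exact D-optimal design with at least twice as many points as parameters bounds every
linear combination of the coordinates of `u`. -/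
theorem exists_design_sq_le {T ι κ : Type*} [TopologicalSpace T] [CompactSpace T] [Fintype κ]
    [Fintype ι] [Nonempty ι] (hcard : 2 * Fintype.card ι ≤ Fintype.card κ)
    {u : T → ι → ℝ} (hu : Continuous u) (hsep : ∀ c : ι → ℝ, (∀ x, u x ⬝ᵥ c = 0) → c = 0) :
    ∃ ξ : κ → T, ∀ (c : ι → ℝ) (x : T), (u x ⬝ᵥ c) ^ 2 ≤ ∑ j, (u (ξ j) ⬝ᵥ c) ^ 2 := by
  classical
  obtain ⟨ξ₀, h₀⟩ := exists_det_designGram_pos (κ := κ) (by lia) hsep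
  obtain ⟨ξ, -, hξ⟩ := isCompact_univ.exists_isMaxOn (s := (Set.univ : Set (κ → T)))
    ⟨ξ₀, trivial⟩ (continuous_det_designGram hu).continuousOn
  have hmax : ∀ η : κ → T, (designGram u η).det ≤ (designGram u ξ).det := fun η => hξ trivial
  have hpos := h₀.trans_le (hmax ξ₀)
  refine ⟨ξ, fun c x => ?_⟩
  have hv := variance_le_of_isMax_det hpos hmax x
  set G := designGram u ξ with hG
  have hcancel : G *ᵥ (G⁻¹ *ᵥ u x) = u x := by
    rw [mulVec_mulVec, mul_nonsing_inv _ hpos.ne'.isUnit, one_mulVec]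
  have hle : u x ⬝ᵥ G⁻¹ *ᵥ u x ≤ 1 := by
    have h2 : (2 * Fintype.card ι : ℝ) ≤ Fintype.card κ := by exact_mod_cast hcard
    have h3 : (0 : ℝ) ≤ Fintype.card ι := Nat.cast_nonneg _
    by_contra! h
    nlinarith
  have hsq : ∑ j, (u (ξ j) ⬝ᵥ G⁻¹ *ᵥ u x) ^ 2 = u x ⬝ᵥ G⁻¹ *ᵥ u x := by
    simp_rw [sq]
    rw [← dotProduct_designGram_mulVec, ← hG, hcancel, dotProduct_comm]
  -- Reproducing formula: write `u x = G (G⁻¹ u x)` and expand `G` over the design.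
  have hx : u x ⬝ᵥ c = ∑ j, (u (ξ j) ⬝ᵥ c) * (u (ξ j) ⬝ᵥ G⁻¹ *ᵥ u x) := by
    rw [← dotProduct_designGram_mulVec, ← hG, hcancel, dotProduct_comm]
  have hcs := Finset.sum_mul_sq_le_sq_mul_sq Finset.univ (fun j => u (ξ j) ⬝ᵥ c)
    (fun j => u (ξ j) ⬝ᵥ G⁻¹ *ᵥ u x)
  rw [← hx, hsq] at hcs
  exact hcs.trans (mul_le_of_le_one_right (Finset.sum_nonneg fun j _ => sq_nonneg _) hle)

open Matrix in
/-- Discretization of the uniform norm on an `N`-dimensional space of continuous functions by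
at most `2 N` points, with constant `√2 √N`. -/
theorem exists_finset_norm_le {T : Type*} [TopologicalSpace T] [CompactSpace T] {N : ℕ}
    (hN : 1 ≤ N) (X : Submodule ℝ C(T, ℝ)) (hX : Module.finrank ℝ X = N) :
    ∃ (S : Finset T) (hS : S.Nonempty), S.card ≤ 2 * N ∧
      ∀ f ∈ X, ‖f‖ ≤ √2 * √(N : ℝ) * S.sup' hS (fun ξ => |f ξ|) := by
  classical
  have : NeZero N := ⟨by lia⟩
  have : NeZero (2 * N) := ⟨by lia⟩
  have : FiniteDimensional ℝ X := FiniteDimensional.of_finrank_pos (by lia)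
  let b := Module.finBasisOfFinrankEq ℝ X hX
  let u : T → Fin N → ℝ := fun x i => (b i : C(T, ℝ)) x
  have hu : Continuous u := continuous_pi fun i => (b i : C(T, ℝ)).continuous
  have heval : ∀ (c : Fin N → ℝ) (x : T), u x ⬝ᵥ c = ((∑ i, c i • b i : X) : C(T, ℝ)) x :=
    fun c x => by simp [u, dotProduct, mul_comm]
  obtain ⟨ξ, hξ⟩ := exists_design_sq_le (κ := Fin (2 * N)) (by simp) hu fun c hc => by
    have h0 : ∑ i, c i • b i = 0 := by
      ext x
      rw [← heval, hc]
      rfl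
    exact funext (Fintype.linearIndependent_iff.1 b.linearIndependent c h0)
  have hS : (Finset.univ.image ξ).Nonempty := Finset.univ_nonempty.image ξ
  refine ⟨Finset.univ.image ξ, hS, Finset.card_image_le.trans (by simp), fun f hf => ?_⟩
  set M := (Finset.univ.image ξ).sup' hS (fun ξ => |f ξ|)
  have hM : ∀ j, |f (ξ j)| ≤ M := fun j =>
    Finset.le_sup' (fun ξ => |f ξ|) (Finset.mem_image_of_mem ξ (Finset.mem_univ j))
  have hM0 : 0 ≤ M := (abs_nonneg _).trans (hM 0)
  have hf' : ∀ x, u x ⬝ᵥ b.repr ⟨f, hf⟩ = f x := fun x => by rw [heval, b.sum_repr]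
  rw [ContinuousMap.norm_le _ (by positivity)]
  intro x
  have h := hξ (b.repr ⟨f, hf⟩) x
  simp_rw [hf'] at h
  rw [Real.norm_eq_abs]
  refine abs_le_of_sq_le_sq (h.trans ?_) (by positivity)
  calc ∑ j, f (ξ j) ^ 2 ≤ ∑ _j : Fin (2 * N), M ^ 2 :=
        Finset.sum_le_sum fun j _ => sq_le_sq' (abs_le.1 (hM j)).1 (abs_le.1 (hM j)).2
    _ = (√2 * √(N : ℝ) * M) ^ 2 := by
        rw [mul_pow, mul_pow, Real.sq_sqrt (by norm_num), Real.sq_sqrt (Nat.cast_nonneg _)]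
        simp

/-- There are absolute constants `C₁, C₂` such that for every compact `Ω ⊆ ℝᵈ` and every real
`N`-dimensional subspace `X` of `C(Ω)` (with its uniform norm) there is a set `S` of at most
`C₁ N` points of `Ω` with `‖f‖_∞ ≤ C₂ √N max_{ξ ∈ S} |f ξ|` for all `f ∈ X`. -/
theorem corollary2p1 :
    ∃ C₁ C₂ : ℝ, 0 < C₁ ∧ 0 < C₂ ∧
      ∀ (d : ℕ) (Ω : Set (EuclideanSpace ℝ (Fin d))) [CompactSpace Ω]
        (N : ℕ) (_ : 1 ≤ N) (X : Submodule ℝ C(Ω, ℝ)) (_ : Module.finrank ℝ X = N),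
        ∃ (S : Finset Ω) (hS : S.Nonempty), (S.card : ℝ) ≤ C₁ * (N : ℝ) ∧
          ∀ f ∈ X, ‖f‖ ≤ C₂ * Real.sqrt (N : ℝ) * S.sup' hS (fun ξ => |f ξ|) := by
  refine ⟨2, √2, by norm_num, by positivity, fun d Ω _ N hN X hX => ?_⟩
  obtain ⟨S, hS, hcard, h⟩ := exists_finset_norm_le hN X hX
  exact ⟨S, hS, by exact_mod_cast hcard, h⟩
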